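/- For a permutation $\pi\in\mathfrak S_n$ let $\mathrm{fix}(\pi)$ be its number of fixed points, $\mathrm{exc}(\pi)$ its number of excedances (indices $i$ with $\pi(i)>i$), and $\mathrm{cda}(\pi)$ its number of cycle double ascents (values $x$ with $\pi^{-1}(x)<x<\pi(x)$). Call $\pi\in\mathfrak S_n$ a simsun permutation of the second kind if, for every $0\le k\le n$, the permutation obtained by deleting the $k$ largest letters from the cycle notation of $\pi$ has no cycle double ascents; let $\mathcal{SS}_n$ be the set of these, and let $\mathcal C_n=\{\pi\in\mathfrak S_n:\mathrm{cda}(\pi)=0\}$. Define $$C(s,x;z)=\sum_{n\ge 0}\sum_{\pi\in\mathcal C_n}s^{\mathrm{fix}(\pi)}x^{\mathrm{exc}(\pi)}\frac{z^n}{n!},\qquad M(s,x;z)=\sum_{n\ge 0}\sum_{\pi\in\mathcal{SS}_n}s^{\mathrm{fix}(\pi)}x^{\mathrm{exc}(\pi)}\frac{z^n}{n!}.$$ **Theorem 2.4.** As formal power series in $z$, $$C(s,x;z)=e^{z\left(s-\frac12\right)}\,\frac{\sqrt{4x-1}\,\sec\left(\frac z2\sqrt{4x-1}\right)}{\sqrt{4x-1}-\tan\left(\frac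 z2\sqrt{4x-1}\right)},$$ and $$C(s,x;z)^2=M(2s,2x;z).$$ Here $s,x$ are arbitrary elements of a field $K$ of characteristic $0$ (for instance independent indeterminates in an extension of $\mathbb Q(s,x)$), and in the first formula $\sqrt{4x-1}$ is any nonzero $r\in K$ with $r^2=4x-1$. -/

import Mathlib

namespace CycleEGF

open Finset

/-- The number `cda π` of cycle double ascents: values `x` with `π⁻¹ x < x < π x`.
The letters `1, …, n` are modelled by `Fin n` with its order. -/
def cda {n : ℕ} (π : Equiv.Perm (Fin n)) : ℕ :=
  #{x : Fin n | π⁻¹ x < x ∧ x < π x}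

/-- The number `fix π` of fixed points. -/
def fixCount {n : ℕ} (π : Equiv.Perm (Fin n)) : ℕ :=
  #{i : Fin n | π i = i}

/-- The number `exc π` of excedances, i.e. indices `i` with `π i > i`. -/
def exc {n : ℕ} (π : Equiv.Perm (Fin n)) : ℕ :=
  #{i : Fin n | i < π i}

/-- The set of permutations of `n` letters without cycle double ascents. -/
def noCda (n : ℕ) : Finset (Equiv.Perm (Fin n)) :=
  {π | cda π = 0}

/-- Remove the largest letter from the cycle notation of a permutation of `n + 1` letters:
the preimage of that letter is sent to its image, and all other values are unchanged. -/
def removeLargest {n : ℕ} (π : Equiv.Perm (Fin (n + 1))) : Equiv.Perm (Fin n) :=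
  Equiv.removeNone (finSuccEquivLast.permCongr π)

/-- The simsun permutations of the second kind of `n` letters: the permutation itself and all
permutations obtained by successively removing its largest letters have no cycle double
ascents. -/
def simsun : (n : ℕ) → Finset (Equiv.Perm (Fin n))
  | 0 => univ
  | n + 1 => {π | cda π = 0 ∧ removeLargest π ∈ simsun n}

variable {K : Type*} [Field K]

/-- The exponential generating function, in the variable `z = PowerSeries.X`, of the permutations
without cycle double ascents, by fixed points (weight `s`) and excedances (weight `x`). -/
noncomputable def egfC (s x : K) : PowerSeries K :=
  PowerSeries.mk fun n => (∑ π ∈ noCda n, s ^ fixCount π * x ^ exc π) / (n.factorial : K)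

/-- The exponential generating function of the simsun permutations of the second kind, by fixed
points (weight `s`) and excedances (weight `x`). -/
noncomputable def egfM (s x : K) : PowerSeries K :=
  PowerSeries.mk fun n => (∑ π ∈ simsun n, s ^ fixCount π * x ^ exc π) / (n.factorial : K)

variable [CharZero K]

/-- The formal power series `exp (c z)`. -/
noncomputable def expz (c : K) : PowerSeries K :=
  PowerSeries.rescale c (PowerSeries.exp K)

/-- The formal power series `sec (c z) = 1 / cos (c z)`. -/
noncomputable def secz (c : K) : PowerSeries K :=
  (PowerSeries.rescale c (PowerSeries.cos K))⁻¹

/-- The formal power series `tan (c z) = sin (c z) / cos (c z)`. -/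
noncomputable def tanz (c : K) : PowerSeries K :=
  PowerSeries.rescale c (PowerSeries.sin K) * (PowerSeries.rescale c (PowerSeries.cos K))⁻¹

end CycleEGF

/-! ### Inserting the largest letter into the cycle notation. -/

namespace CycleEGF

open Finset

/-! Weight each letter by its type: fixed point `s`, peak `X`, valley 1, double descent `w`, double
ascent `y`. Inserting a new largest letter into an arc adds a peak and changes the type of just one
old letter. So summing over all insertions acts as multiplication by `s` (new fixed point) plus a
derivation with s, w, y ↦ X and X ↦ (w + y)X (`derivation_weight_add`).

This derivation is realised as d/dz by replacing s, w, y with s + t, 1 + t, t, where t' = X = x + t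
+ t², and multiplying by E with E' = (s + t)E, E(0) = 1. The n-th derivative of E is E times the
total weight over S_n; at z = 0, where y = t = 0, only cda = 0 survives, so C = E. Simsun
permutations keep y = 0, which gives the system t' = X, X' = (1 + t)X. If (s, x, t, X, E) solves the
first system, then (2s, 2x, 2t, 2X, E²) solves the second; hence C² = M.

Finally t = -u'/u linearises the Riccati equation to u'' = u' - xu, with E = e^{sz}/u. -/

/-- Insert a new largest letter into the cycle notation of a permutation: as a fixed point for
`none`, immediately before the letter `j` for `some j`. -/
def insertLargest {n : ℕ} (π : Equiv.Perm (Fin n)) (j : Option (Fin n)) :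
    Equiv.Perm (Fin (n + 1)) :=
  finSuccEquivLast.permCongr.symm (Equiv.Perm.decomposeOption.symm (j, π))

theorem removeLargest_insertLargest {n : ℕ} (π : Equiv.Perm (Fin n)) (j : Option (Fin n)) :
    removeLargest (insertLargest π j) = π := by
  rw [removeLargest, insertLargest, Equiv.apply_symm_apply]
  exact congrArg Prod.snd (Equiv.Perm.decomposeOption.apply_symm_apply (j, π))

/-- A permutation of `n + 1` letters amounts to one of `n` letters together with the place at which
the largest letter is inserted. -/
def insertLargestEquiv (n : ℕ) :
    Equiv.Perm (Fin n) × Option (Fin n) ≃ Equiv.Perm (Fin (n + 1)) :=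
  (Equiv.prodComm _ _).trans
    (Equiv.Perm.decomposeOption.symm.trans finSuccEquivLast.permCongr.symm)

theorem insertLargestEquiv_apply {n : ℕ} (p : Equiv.Perm (Fin n) × Option (Fin n)) :
    insertLargestEquiv n p = insertLargest p.1 p.2 := rfl

section apply

variable {n : ℕ} (π : Equiv.Perm (Fin n))

theorem insertLargest_none_castSucc (i : Fin n) :
    insertLargest π none i.castSucc = (π i).castSucc := by
  simp [insertLargest, Equiv.permCongr_def]

theorem insertLargest_none_last : insertLargest π none (Fin.last n) = Fin.last n := by
  simp [insertLargest, Equiv.permCongr_def]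

theorem insertLargest_some_castSucc_of_ne {i j : Fin n} (h : π i ≠ j) :
    insertLargest π (some j) i.castSucc = (π i).castSucc := by
  have h' : Equiv.swap none (some j) (some (π i)) = some (π i) :=
    Equiv.swap_apply_of_ne_of_ne (by simp) (by simpa using h)
  simp [insertLargest, Equiv.permCongr_def, h']

theorem insertLargest_some_castSucc_of_eq {i j : Fin n} (h : π i = j) :
    insertLargest π (some j) i.castSucc = Fin.last n := by
  simp [insertLargest, Equiv.permCongr_def, h]

theorem insertLargest_some_last (j : Fin n) :
    insertLargest π (some j) (Fin.last n) = j.castSucc := by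
  simp [insertLargest, Equiv.permCongr_def]

theorem insertLargest_none_inv_castSucc (i : Fin n) :
    (insertLargest π none)⁻¹ i.castSucc = (π⁻¹ i).castSucc := by
  rw [Equiv.Perm.inv_eq_iff_eq, insertLargest_none_castSucc]; simp

theorem insertLargest_none_inv_last : (insertLargest π none)⁻¹ (Fin.last n) = Fin.last n := by
  rw [Equiv.Perm.inv_eq_iff_eq, insertLargest_none_last]

theorem insertLargest_some_inv_castSucc_of_ne {i j : Fin n} (h : i ≠ j) :
    (insertLargest π (some j))⁻¹ i.castSucc = (π⁻¹ i).castSucc := by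
  rw [Equiv.Perm.inv_eq_iff_eq, insertLargest_some_castSucc_of_ne _ (by simpa using h)]
  simp

theorem insertLargest_some_inv_castSucc_self (j : Fin n) :
    (insertLargest π (some j))⁻¹ j.castSucc = Fin.last n := by
  rw [Equiv.Perm.inv_eq_iff_eq, insertLargest_some_last]

theorem insertLargest_some_inv_last (j : Fin n) :
    (insertLargest π (some j))⁻¹ (Fin.last n) = (π⁻¹ j).castSucc := by
  rw [Equiv.Perm.inv_eq_iff_eq, insertLargest_some_castSucc_of_eq]; simp

end apply

/-! ### Letter weights and the insertion recurrence. -/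

variable {R : Type*} [CommRing R]

/-- The weight of a letter `b` of a permutation with preimage `a` and image `c`: `s` for a fixed
point, `X` for a peak, `1` for a valley, `w` for a double descent, `y` for a double ascent. -/
def letterWeight {α : Type*} [LinearOrder α] (s X w y : R) (a b c : α) : R :=
  if a < b then (if b < c then y else X)
  else if b < a then (if b < c then 1 else w) else s

/-- The product of the weights of the letters. -/
def weight (s X w y : R) {n : ℕ} (π : Equiv.Perm (Fin n)) : R :=
  ∏ k, letterWeight s X w y (π⁻¹ k) k (π k)

/-- The change of `letterWeight` when a new largest letter, of weight `X`, is inserted into one of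
the arcs attributed to the letter `b`. -/
def letterStep {α : Type*} [LinearOrder α] (X w y : R) (a b c : α) : R :=
  if a < b then (if b < c then X else (w + y) * X)
  else if b < a then (if b < c then 0 else X) else X

/-- The part of `letterStep` coming from a fixed point or an ascending arc that ends in `b`. -/
def letterStepIn {α : Type*} [LinearOrder α] (X w : R) (a b c : α) : R :=
  if a < b then (if b < c then X else w * X) else if b < a then 0 else X

/-- The part of `letterStep` coming from a descending arc that starts in `b`. -/
def letterStepOut {α : Type*} [LinearOrder α] (X y : R) (a b c : α) : R :=
  if c < b then (if a < b then y * X else X) else 0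

variable {n : ℕ} (π : Equiv.Perm (Fin n)) (s X w y : R)

theorem letterStepIn_add_letterStepOut (k : Fin n) :
    letterStepIn X w (π⁻¹ k) k (π k) + letterStepOut X y (π⁻¹ k) k (π k) =
      letterStep X w y (π⁻¹ k) k (π k) := by
  have h : π⁻¹ k = k ↔ π k = k := by rw [Equiv.Perm.inv_eq_iff_eq, eq_comm]
  simp only [letterStepIn, letterStepOut, letterStep]
  rcases lt_trichotomy (π⁻¹ k) k with h1 | h1 | h1 <;>
    rcases lt_trichotomy (π k) k with h2 | h2 | h2 <;>
    simp_all [lt_asymm, ne_of_lt, ne_of_gt]; ring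

theorem weight_insertLargest_none :
    weight s X w y (insertLargest π none) = s * weight s X w y π := by
  simp only [weight, Fin.prod_univ_castSucc, insertLargest_none_inv_castSucc,
    insertLargest_none_castSucc, insertLargest_none_inv_last, insertLargest_none_last]
  simp [letterWeight, mul_comm]

theorem weight_insertLargest_some (j : Fin n) :
    weight s X w y (insertLargest π (some j)) =
      (∏ k : Fin n, letterWeight s X w y ((insertLargest π (some j))⁻¹ k.castSucc) k.castSucc
        (insertLargest π (some j) k.castSucc)) * X := by
  rw [weight, Fin.prod_univ_castSucc, insertLargest_some_inv_last, insertLargest_some_last]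
  simp [letterWeight, Fin.castSucc_lt_last, (Fin.castSucc_lt_last _).not_gt]

/-- Cutting an ascending arc or a loop ending in `j` leaves the start of an ascending arc with a
larger image, so only the type of `j` changes. -/
theorem weight_insertLargest_some_of_le (j : Fin n) (h : π⁻¹ j ≤ j) :
    weight s X w y (insertLargest π (some j)) =
      (∏ k ∈ univ.erase j, letterWeight s X w y (π⁻¹ k) k (π k)) *
        letterStepIn X w (π⁻¹ j) j (π j) := by
  rw [weight_insertLargest_some, ← prod_erase_mul _ _ (mem_univ j), mul_assoc]
  congr 1
  · refine prod_congr rfl fun k hk => ?_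
    have hkj := ne_of_mem_erase hk
    rw [insertLargest_some_inv_castSucc_of_ne π hkj]
    by_cases hk' : π k = j
    · have hk2 : k < j := by
        subst hk'; exact lt_of_le_of_ne (by simpa using h) hkj
      rw [insertLargest_some_castSucc_of_eq π hk']
      simp [letterWeight, Fin.castSucc_lt_last, hk', hk2]
    · rw [insertLargest_some_castSucc_of_ne π hk']
      simp [letterWeight]
  · rw [insertLargest_some_inv_castSucc_self]
    by_cases hk' : π j = j
    · have : π⁻¹ j = j := by rw [Equiv.Perm.inv_eq_iff_eq, hk']
      rw [insertLargest_some_castSucc_of_eq π hk']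
      simp [letterWeight, letterStepIn, Fin.castSucc_lt_last, (Fin.castSucc_lt_last _).not_gt, this]
    · have h2 : π⁻¹ j < j := lt_of_le_of_ne h fun e => hk' (by
        rw [Equiv.Perm.inv_eq_iff_eq] at e; exact e.symm)
      rw [insertLargest_some_castSucc_of_ne π hk']
      by_cases h3 : j < π j <;>
      simp [-Equiv.Perm.coe_inv, letterWeight, letterStepIn, Fin.castSucc_lt_last, (Fin.castSucc_lt_last _).not_gt,
        h2, h3]

/-- Dually, the end of a descending arc keeps a larger preimage, so only the type of its start `i`
changes. -/
theorem weight_insertLargest_some_of_lt (i : Fin n) (h : π i < i) :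
    weight s X w y (insertLargest π (some (π i))) =
      (∏ k ∈ univ.erase i, letterWeight s X w y (π⁻¹ k) k (π k)) *
        letterStepOut X y (π⁻¹ i) i (π i) := by
  rw [weight_insertLargest_some, ← prod_erase_mul _ _ (mem_univ i), mul_assoc]
  congr 1
  · refine prod_congr rfl fun k hk => ?_
    have hki := ne_of_mem_erase hk
    rw [insertLargest_some_castSucc_of_ne π (by simpa using hki)]
    by_cases hk' : k = π i
    · subst hk'
      rw [insertLargest_some_inv_castSucc_self]
      simp [letterWeight, (Fin.castSucc_lt_last _).not_gt, h, h.not_gt, Fin.castSucc_lt_last]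
    · rw [insertLargest_some_inv_castSucc_of_ne π hk']
      simp [letterWeight]
  · have h1 : π⁻¹ i ≠ i := by
      rw [Ne, Equiv.Perm.inv_eq_iff_eq]; exact h.ne'
    rw [insertLargest_some_castSucc_of_eq π rfl, insertLargest_some_inv_castSucc_of_ne π h.ne']
    rcases lt_or_gt_of_ne h1 with h2 | h2 <;>
      simp [-Equiv.Perm.coe_inv, letterWeight, letterStepOut, Fin.castSucc_lt_last, h, h2, h2.not_gt]

theorem sum_weight_insertLargest :
    ∑ j, weight s X w y (insertLargest π j) = s * weight s X w y π +
      ∑ k, (∏ l ∈ univ.erase k, letterWeight s X w y (π⁻¹ l) l (π l)) *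
        letterStep X w y (π⁻¹ k) k (π k) := by
  rw [Fintype.sum_option, weight_insertLargest_none]
  congr 1
  -- Of the two terms, the one not matching the direction of the arc into `j` vanishes. The second
  -- is then reindexed along `π⁻¹`, so that each letter collects all arcs charged to it.
  have key : ∀ j, weight s X w y (insertLargest π (some j)) =
      (∏ k ∈ univ.erase j, letterWeight s X w y (π⁻¹ k) k (π k)) *
        letterStepIn X w (π⁻¹ j) j (π j) +
      (∏ k ∈ univ.erase (π⁻¹ j), letterWeight s X w y (π⁻¹ k) k (π k)) *
        letterStepOut X y (π⁻¹ (π⁻¹ j)) (π⁻¹ j) (π (π⁻¹ j)) := by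
    intro j
    rcases le_or_gt (π⁻¹ j) j with h | h
    · rw [weight_insertLargest_some_of_le _ _ _ _ _ _ h]
      have h' : letterStepOut X y (π⁻¹ (π⁻¹ j)) (π⁻¹ j) (π (π⁻¹ j)) = 0 :=
        if_neg (by rw [show π (π⁻¹ j) = j by simp]; exact h.not_gt)
      rw [h', mul_zero, add_zero]
    · have := weight_insertLargest_some_of_lt π s X w y (π⁻¹ j) (by simpa using h)
      rw [show π (π⁻¹ j) = j by simp] at this ⊢
      have h' : letterStepIn X w (π⁻¹ j) j (π j) = 0 := by
        rw [letterStepIn, if_neg h.not_gt, if_pos h]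
      rw [this, h', mul_zero, zero_add]
  rw [sum_congr rfl fun j _ => key j, sum_add_distrib,
    Equiv.sum_comp π⁻¹ fun k => (∏ l ∈ univ.erase k, letterWeight s X w y (π⁻¹ l) l (π l)) *
      letterStepOut X y (π⁻¹ k) k (π k), ← sum_add_distrib]
  refine sum_congr rfl fun k _ => ?_
  rw [← mul_add, letterStepIn_add_letterStepOut]

theorem derivation_prod {A ι : Type*} [CommRing A] [Algebra A R] [DecidableEq ι]
    (D : Derivation A R R) (t : Finset ι) (f : ι → R) :
    D (∏ i ∈ t, f i) = ∑ i ∈ t, (∏ j ∈ t.erase i, f j) * D (f i) := by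
  induction t using Finset.induction_on with
  | empty => simp
  | insert a t ha ih =>
    rw [prod_insert ha, Derivation.leibniz, ih, sum_insert ha, erase_insert ha, smul_eq_mul,
      smul_eq_mul, mul_sum, add_comm]
    congr 1
    refine sum_congr rfl fun i hi => ?_
    rw [erase_insert_of_ne (ne_of_mem_of_not_mem hi ha).symm,
      prod_insert (fun h => ha (mem_of_mem_erase h)), mul_assoc]

/-- The rule for `D` is required only on types occurring in `π`, so `y = 0` is allowed when `π` has
no double ascents. -/
theorem derivation_weight_add {A : Type*} [CommRing A] [Algebra A R] (D : Derivation A R R)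
    (h : ∀ k, D (letterWeight s X w y (π⁻¹ k) k (π k)) = letterStep X w y (π⁻¹ k) k (π k)) :
    s * weight s X w y π + D (weight s X w y π) = ∑ j, weight s X w y (insertLargest π j) := by
  rw [sum_weight_insertLargest, weight, derivation_prod]
  simp only [h]

theorem sum_weight_univ_succ (n : ℕ) :
    ∑ π : Equiv.Perm (Fin (n + 1)), weight s X w y π =
      ∑ π : Equiv.Perm (Fin n), ∑ j, weight s X w y (insertLargest π j) := by
  rw [← (insertLargestEquiv n).sum_comp, Fintype.sum_prod_type]
  rfl

theorem weight_eq_zero_of_cda (h : cda π ≠ 0) : weight s X w 0 π = 0 := by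
  obtain ⟨k, hk⟩ := card_ne_zero.1 h
  simp only [mem_filter, mem_univ, true_and] at hk
  exact prod_eq_zero (mem_univ k) (by rw [letterWeight, if_pos hk.1, if_pos hk.2])

theorem not_lt_of_cda_eq_zero {π : Equiv.Perm (Fin n)} (h : cda π = 0) (k : Fin n)
    (h1 : π⁻¹ k < k) : ¬ k < π k := by
  intro h2
  have := filter_eq_empty_iff.1 (card_eq_zero.1 h) (mem_univ k)
  exact this ⟨h1, h2⟩

/-- With `y = 0`, insertions that create a double ascent have weight zero, so they may be included
freely. -/
theorem sum_weight_simsun_succ (n : ℕ) :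
    ∑ π ∈ simsun (n + 1), weight s X w 0 π =
      ∑ π ∈ simsun n, ∑ j, weight s X w 0 (insertLargest π j) := by
  calc ∑ π ∈ simsun (n + 1), weight s X w 0 π
      = ∑ π : Equiv.Perm (Fin (n + 1)),
          if removeLargest π ∈ simsun n then weight s X w 0 π else 0 := by
        rw [simsun, sum_filter]
        refine sum_congr rfl fun π _ => ?_
        by_cases h : cda π = 0
        · simp [h]
        · simp [h, weight_eq_zero_of_cda]
    _ = ∑ π : Equiv.Perm (Fin n), ∑ j,
          if π ∈ simsun n then weight s X w 0 (insertLargest π j) else 0 := by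
        rw [← (insertLargestEquiv n).sum_comp, Fintype.sum_prod_type]
        simp only [insertLargestEquiv_apply, removeLargest_insertLargest]
    _ = _ := by
        rw [← sum_subset (subset_univ (simsun n))]
        · exact sum_congr rfl fun π hπ => by simp [hπ]
        · intro π _ hπ; simp [hπ]

end CycleEGF

namespace CycleEGF

open Finset PowerSeries

/-! ### Specialising the weights to `fix` and `exc`. -/

section counts

variable {n : ℕ} {R : Type*} [CommRing R]

theorem exc_eq_card_preimage_lt (π : Equiv.Perm (Fin n)) :
    exc π = #{k : Fin n | π⁻¹ k < k} := by
  refine card_bij (fun i _ => π i) ?_ (fun i _ j _ h => π.injective h) ?_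
  · intro i hi
    simpa using hi
  · intro k hk
    exact ⟨π⁻¹ k, by simpa using hk, by simp⟩

theorem weight_of_cda_eq_zero {π : Equiv.Perm (Fin n)} (h : cda π = 0) (s X : R) :
    weight s X 1 0 π = s ^ fixCount π * X ^ exc π := by
  have key : ∀ k, letterWeight s X 1 0 (π⁻¹ k) k (π k) =
      (if π k = k then s else 1) * (if π⁻¹ k < k then X else 1) := by
    intro k
    have h0 : π⁻¹ k = k ↔ π k = k := by rw [Equiv.Perm.inv_eq_iff_eq, eq_comm]
    rw [letterWeight]
    rcases lt_trichotomy (π⁻¹ k) k with h1 | h1 | h1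
    · rw [if_pos h1, if_neg (not_lt_of_cda_eq_zero h k h1), if_neg (fun e => h1.ne (h0.2 e)),
        if_pos h1, one_mul]
    · rw [if_neg h1.not_lt, if_neg h1.not_gt, if_pos (h0.1 h1), if_neg h1.not_lt, mul_one]
    · rw [if_neg h1.not_gt, if_pos h1, if_neg (fun e => h1.ne' (h0.2 e)), if_neg h1.not_gt, ite_self,
        one_mul]
  rw [weight, prod_congr rfl fun k _ => key k, prod_mul_distrib, prod_ite, prod_ite, prod_const_one,
    prod_const_one, prod_const, prod_const, mul_one, mul_one, exc_eq_card_preimage_lt, fixCount]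

theorem cda_eq_zero_of_mem_simsun {π : Equiv.Perm (Fin n)} (h : π ∈ simsun n) : cda π = 0 := by
  cases n with
  | zero => simp [cda]
  | succ n => rw [simsun, mem_filter] at h; exact h.2.1

theorem sum_noCda (s X : R) :
    ∑ π ∈ noCda n, s ^ fixCount π * X ^ exc π =
      ∑ π : Equiv.Perm (Fin n), weight s X 1 0 π := by
  rw [noCda, sum_filter]
  refine sum_congr rfl fun π _ => ?_
  split_ifs with h
  · rw [weight_of_cda_eq_zero h]
  · rw [weight_eq_zero_of_cda _ _ _ _ h]

theorem sum_simsun (s X : R) :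
    ∑ π ∈ simsun n, s ^ fixCount π * X ^ exc π = ∑ π ∈ simsun n, weight s X 1 0 π :=
  sum_congr rfl fun _ h => (weight_of_cda_eq_zero (cda_eq_zero_of_mem_simsun h) s X).symm

theorem map_weight {S : Type*} [CommRing S] (f : R →+* S) (s X w y : R)
    (π : Equiv.Perm (Fin n)) : f (weight s X w y π) = weight (f s) (f X) (f w) (f y) π := by
  simp only [weight, map_prod, letterWeight, apply_ite f, map_one]

end counts

/-! ### From the recurrence to differential equations. -/

variable {K : Type*} [Field K] [CharZero K]

/-- Taylor's formula at 0, since `F n` is the `n`-th derivative of `F 0`. -/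
theorem eq_mk_of_derivative_eq_succ (F : ℕ → PowerSeries K)
    (h : ∀ n, d⁄dX K (F n) = F (n + 1)) :
    F 0 = PowerSeries.mk fun n => constantCoeff (F n) / (n.factorial : K) := by
  have hit : ∀ n, (d⁄dX K)^[n] (F 0) = F n := by
    intro n
    induction n with
    | zero => rfl
    | succ n ih => rw [Function.iterate_succ_apply', ih, h]
  ext n
  rw [coeff_mk, ← hit n, constantCoeff_iterate_derivative, mul_div_cancel_left₀]
  exact_mod_cast n.factorial_ne_zero

/-- Permutations without cycle double ascents are enumerated by the solution of the system
`E' = (s + t) E`, `t' = x + t + t ^ 2`. -/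
theorem egfC_eq_of_derivative {s x : K} {E t : PowerSeries K}
    (hE : d⁄dX K E = (C s + t) * E) (hE0 : constantCoeff E = 1)
    (ht : d⁄dX K t = C x + t + t ^ 2) (ht0 : constantCoeff t = 0) :
    egfC s x = E := by
  set X : PowerSeries K := C x + t + t ^ 2 with hX
  have hdX : d⁄dX K X = (1 + t + t) * X := by
    rw [hX]
    simp only [map_add, derivative_C, Derivation.leibniz_pow, ht, smul_eq_mul, nsmul_eq_mul]
    rw [hX]
    push_cast
    ring
  have key := eq_mk_of_derivative_eq_succ
    (fun n => (∑ π : Equiv.Perm (Fin n), weight (C s + t) X (1 + t) t π) * E) (by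
      intro n
      rw [sum_weight_univ_succ, Derivation.leibniz, hE, map_sum, smul_eq_mul, smul_eq_mul,
        sum_congr rfl fun π _ => (derivation_weight_add π (C s + t) X (1 + t) t (d⁄dX K)
          fun k => ?_).symm, sum_add_distrib, ← mul_sum]
      · ring
      · simp only [letterWeight, letterStep, apply_ite (d⁄dX K), map_add, derivative_C, ht, hdX,
          Derivation.map_one_eq_zero, zero_add])
  have h0 : constantCoeff X = x := by simp [hX, ht0]
  simp only [map_mul, map_sum, map_weight, map_add, ht0, h0, hE0, map_one, constantCoeff_C,
    add_zero, mul_one] at key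
  rw [egfC]
  simp only [sum_noCda]
  rw [← key]
  simp [weight]

/-- Simsun permutations of the second kind are enumerated by the solution of the system
`E' = (s + t) E`, `t' = X`, `X' = (1 + t) X`, in which `X(0) = x`. -/
theorem egfM_eq_of_derivative {s x : K} {E t X : PowerSeries K}
    (hE : d⁄dX K E = (C s + t) * E) (hE0 : constantCoeff E = 1)
    (ht : d⁄dX K t = X) (ht0 : constantCoeff t = 0)
    (hdX : d⁄dX K X = (1 + t) * X) (h0 : constantCoeff X = x) :
    egfM s x = E := by
  have key := eq_mk_of_derivative_eq_succ
    (fun n => (∑ π ∈ simsun n, weight (C s + t) X (1 + t) 0 π) * E) (by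
      intro n
      rw [sum_weight_simsun_succ, Derivation.leibniz, hE, map_sum, smul_eq_mul, smul_eq_mul,
        sum_congr rfl fun π hπ => (derivation_weight_add π (C s + t) X (1 + t) 0 (d⁄dX K)
          fun k => ?_).symm, sum_add_distrib, ← mul_sum]
      · ring
      -- An ascent into `k` makes `k` a peak, so the rule y ↦ X, false for y = 0, is never needed.
      · by_cases h1 : π⁻¹ k < k
        · simp only [letterWeight, letterStep, if_pos h1, add_zero, hdX,
            if_neg (not_lt_of_cda_eq_zero (cda_eq_zero_of_mem_simsun hπ) k h1)]
        · simp only [letterWeight, letterStep, if_neg h1, apply_ite (d⁄dX K), map_add,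
            derivative_C, ht, Derivation.map_one_eq_zero, zero_add])
  simp only [map_mul, map_sum, map_weight, map_add, ht0, h0, hE0, map_one, constantCoeff_C,
    add_zero, mul_one, map_zero] at key
  rw [egfM]
  simp only [sum_simsun]
  rw [← key]
  simp [weight, simsun]

/-! ### Derivatives of exponential, sine and cosine series. -/

theorem derivative_rescale {K : Type*} [Field K] (c : K) (f : PowerSeries K) :
    d⁄dX K (rescale c f) = C c * rescale c (d⁄dX K f) := by
  ext n
  simp only [coeff_derivative, coeff_rescale, coeff_C_mul]
  ring

theorem derivative_expz (c : K) : d⁄dX K (expz c) = C c * expz c := by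
  rw [expz, derivative_rescale, derivative_exp]

theorem constantCoeff_expz (c : K) : constantCoeff (expz c) = 1 := by
  rw [expz, ← coeff_zero_eq_constantCoeff_apply, coeff_rescale]
  simp

theorem expz_mul_expz (a b : K) : expz a * expz b = expz (a + b) :=
  exp_mul_exp_eq_exp_add a b

theorem derivative_sin : d⁄dX K (sin K) = cos K := by
  ext n
  have hn : ((n : K) + 1) ≠ 0 := by exact_mod_cast n.succ_ne_zero
  have hf : (n.factorial : K) ≠ 0 := by exact_mod_cast n.factorial_ne_zero
  rw [coeff_derivative, sin, cos, coeff_mk, coeff_mk]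
  rcases Nat.even_or_odd' n with ⟨m, rfl | rfl⟩
  · rw [if_neg (by simp), if_pos (by simp),
      show (2 * m + 1) / 2 = m by omega, show 2 * m / 2 = m by omega]
    simp [Nat.factorial_succ]
    push_cast at hn hf ⊢
    field_simp
  · rw [if_pos (by simp [Nat.even_add_one]), if_neg (by simp)]
    simp

theorem derivative_cos : d⁄dX K (cos K) = -sin K := by
  ext n
  have hn : ((n : K) + 1) ≠ 0 := by exact_mod_cast n.succ_ne_zero
  have hf : (n.factorial : K) ≠ 0 := by exact_mod_cast n.factorial_ne_zero
  rw [coeff_derivative, map_neg, sin, cos, coeff_mk, coeff_mk]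
  rcases Nat.even_or_odd' n with ⟨m, rfl | rfl⟩
  · rw [if_neg (by simp), if_pos (by simp)]
    simp
  · rw [if_pos (by simp [Nat.even_add_one]), if_neg (by simp),
      show (2 * m + 1 + 1) / 2 = m + 1 by omega, show (2 * m + 1) / 2 = m by omega]
    simp [Nat.factorial_succ, pow_succ]
    push_cast at hn hf ⊢
    field_simp

/-! ### Linearising the Riccati equation. -/

section linear

variable {s x : K} {u : PowerSeries K}

/-- The substitution `t = -u' / u` turns the Riccati equation `t' = x + t + t ^ 2` into a linear
one. -/
theorem derivative_riccati (hu : d⁄dX K (d⁄dX K u) = d⁄dX K u - C x * u)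
    (hu0 : constantCoeff u = 1) :
    d⁄dX K (-(d⁄dX K u * u⁻¹)) =
      C x + -(d⁄dX K u * u⁻¹) + (-(d⁄dX K u * u⁻¹)) ^ 2 := by
  have h1 : u * u⁻¹ = 1 := PowerSeries.mul_inv_cancel _ (by rw [hu0]; exact one_ne_zero)
  simp only [map_neg, Derivation.leibniz, hu, derivative_inv', smul_eq_mul]
  linear_combination C x * h1

theorem derivative_expz_mul_inv :
    d⁄dX K (expz s * u⁻¹) = (C s + -(d⁄dX K u * u⁻¹)) * (expz s * u⁻¹) := by
  simp only [Derivation.leibniz, derivative_inv', smul_eq_mul, derivative_expz]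
  ring

theorem constantCoeff_expz_mul_inv (hu0 : constantCoeff u = 1) :
    constantCoeff (expz s * u⁻¹) = 1 := by
  simp [constantCoeff_expz, hu0]

theorem egfC_eq_expz_mul_inv (hu : d⁄dX K (d⁄dX K u) = d⁄dX K u - C x * u)
    (hu0 : constantCoeff u = 1) (hu1 : constantCoeff (d⁄dX K u) = 0) :
    egfC s x = expz s * u⁻¹ :=
  egfC_eq_of_derivative (derivative_expz_mul_inv) (constantCoeff_expz_mul_inv hu0)
    (derivative_riccati hu hu0) (by simp [hu1])

theorem egfM_eq_sq (hu : d⁄dX K (d⁄dX K u) = d⁄dX K u - C x * u)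
    (hu0 : constantCoeff u = 1) (hu1 : constantCoeff (d⁄dX K u) = 0) :
    egfM (2 * s) (2 * x) = (expz s * u⁻¹) ^ 2 := by
  have hr := derivative_riccati hu hu0
  have hE := derivative_expz_mul_inv (s := s) (u := u)
  have hE0 := constantCoeff_expz_mul_inv (s := s) hu0
  have ht0 : constantCoeff (-(d⁄dX K u * u⁻¹)) = 0 := by simp [hu1]
  generalize -(d⁄dX K u * u⁻¹) = t at *
  generalize expz s * u⁻¹ = E at *
  have h2 : d⁄dX K (2 : PowerSeries K) = 0 := (d⁄dX K).map_natCast 2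
  refine egfM_eq_of_derivative (t := 2 * t) (X := 2 * (C x + t + t ^ 2)) ?_ ?_ ?_ ?_ ?_ ?_
  · simp only [Derivation.leibniz_pow, hE, smul_eq_mul, nsmul_eq_mul, map_mul, map_ofNat]
    push_cast
    ring
  · simp [hE0]
  · simp only [Derivation.leibniz, hr, h2, smul_eq_mul]
    ring
  · simp [ht0]
  · simp only [Derivation.leibniz, Derivation.leibniz_pow, hr, h2, smul_eq_mul, nsmul_eq_mul,
      map_add, derivative_C]
    push_cast
    ring
  · simp only [map_mul, map_add, map_pow, ht0, constantCoeff_C, map_ofNat]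
    ring

end linear

/-- The coefficients, up to factorials, of the solution of `u'' = u' - x u`, `u(0) = 1`,
`u'(0) = 0`. -/
def linCoeff (x : K) : ℕ → K
  | 0 => 1
  | 1 => 0
  | n + 2 => linCoeff x (n + 1) - x * linCoeff x n

/-- Serves the identity C² = M, where `4 * x - 1` may be zero or a non-square. -/
theorem exists_linear_solution (x : K) :
    ∃ u : PowerSeries K, d⁄dX K (d⁄dX K u) = d⁄dX K u - C x * u ∧
      constantCoeff u = 1 ∧ constantCoeff (d⁄dX K u) = 0 := by
  refine ⟨PowerSeries.mk fun n => linCoeff x n / (n.factorial : K), ?_, ?_, ?_⟩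
  · ext n
    have hn : ((n : K) + 1) ≠ 0 := by exact_mod_cast n.succ_ne_zero
    have hn2 : ((n : K) + 1 + 1) ≠ 0 := by exact_mod_cast (n + 1).succ_ne_zero
    have hf : (n.factorial : K) ≠ 0 := by exact_mod_cast n.factorial_ne_zero
    simp only [coeff_derivative, map_sub, coeff_C_mul, coeff_mk, linCoeff, Nat.factorial_succ]
    push_cast
    field_simp
  · simp [linCoeff]
  · rw [← coeff_zero_eq_constantCoeff_apply, coeff_derivative, coeff_mk]
    simp [linCoeff]

end CycleEGF

/-! ### The trigonometric closed form. -/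

open PowerSeries in
theorem CycleEGF.egfC_eq_trigonometric {K : Type*} [Field K] [CharZero K] (s x r : K)
    (hr : r ^ 2 = 4 * x - 1) (hr0 : r ≠ 0) :
    CycleEGF.egfC s x =
      CycleEGF.expz (s - 1 / 2) * (PowerSeries.C r * CycleEGF.secz (r / 2)) *
        (PowerSeries.C r - CycleEGF.tanz (r / 2))⁻¹ := by
  have hdc : d⁄dX K (rescale (r / 2) (cos K)) = -(C (r / 2) * rescale (r / 2) (sin K)) := by
    rw [derivative_rescale, derivative_cos, map_neg, mul_neg]
  have hds : d⁄dX K (rescale (r / 2) (sin K)) = C (r / 2) * rescale (r / 2) (cos K) := by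
    rw [derivative_rescale, derivative_sin]
  have hc0 : constantCoeff (rescale (r / 2) (cos K)) = 1 := by
    rw [← coeff_zero_eq_constantCoeff_apply, coeff_rescale, cos, coeff_mk]; simp
  have hs0 : constantCoeff (rescale (r / 2) (sin K)) = 0 := by
    rw [← coeff_zero_eq_constantCoeff_apply, coeff_rescale, sin, coeff_mk]; simp
  have hde := derivative_expz (1 / 2 : K)
  have he0 := constantCoeff_expz (1 / 2 : K)
  have hes : expz s = expz (s - 1 / 2) * expz (1 / 2 : K) := by
    rw [expz_mul_expz, sub_add_cancel]
  rw [secz, tanz]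
  generalize rescale (r / 2) (cos K) = c at *
  generalize rescale (r / 2) (sin K) = σ at *
  generalize expz (1 / 2 : K) = e at *
  have hx : x = (r ^ 2 + 1) / 4 := by rw [hr]; ring
  have hcc : c * c⁻¹ = 1 := PowerSeries.mul_inv_cancel _ (by simp [hc0])
  have hrr : C r * C r⁻¹ = (1 : PowerSeries K) := by
    rw [← map_mul, mul_inv_cancel₀ hr0, map_one]
  have h2 : C (1 / 2 : K) * 2 = (1 : PowerSeries K) := by
    rw [← map_ofNat C 2, ← map_mul]; norm_num
  have hrh : C (r / 2) = C r * C (1 / 2 : K) := by rw [← map_mul]; congr 1; ring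
  have hxh : C x = (C r ^ 2 + 1) * C (1 / 2 : K) ^ 2 := by
    rw [← map_pow, ← map_pow, ← map_one C, ← map_add, ← map_mul, hx]; congr 1; ring
  -- The characteristic roots of u'' = u' - xu are (1 ± ir)/2; the coefficient -1/r of the sine
  -- makes u'(0) = 0.
  have hu' : d⁄dX K (e * (c - C r⁻¹ * σ)) =
      -(e * (C r * C (1 / 2 : K) + C r⁻¹ * C (1 / 2 : K)) * σ) := by
    simp only [Derivation.leibniz, map_sub, hdc, hds, hde, derivative_C, smul_eq_mul, hrh]
    linear_combination -(e * C (1 / 2 : K) * c) * hrr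
  have hu := egfC_eq_expz_mul_inv (s := s) (x := x) (u := e * (c - C r⁻¹ * σ)) (by
    rw [hu']
    simp only [Derivation.leibniz, map_neg, map_add, hds, hde, derivative_C, smul_eq_mul, hrh,
      hxh]
    linear_combination (-(C r + C r⁻¹) * e * σ * C (1 / 2 : K)) * h2 -
      e * C (1 / 2 : K) ^ 2 * (σ * C r + c) * hrr) (by simp [he0, hc0, hs0]) (by rw [hu']; simp [hs0])
  have hden : constantCoeff (C r - σ * c⁻¹) ≠ 0 := by simp [hs0, hr0]
  have hu0 : constantCoeff (e * (c - C r⁻¹ * σ)) ≠ 0 := by simp [he0, hc0, hs0]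
  rw [hu, hes, PowerSeries.eq_mul_inv_iff_mul_eq hden, mul_right_comm, eq_comm,
    PowerSeries.eq_mul_inv_iff_mul_eq hu0]
  linear_combination expz (s - 1 / 2) * e * (C r * hcc - c⁻¹ * σ * hrr)

theorem theorem2p4 {K : Type*} [Field K] [CharZero K] (s x : K) :
    (∀ r : K, r ^ 2 = 4 * x - 1 → r ≠ 0 →
      CycleEGF.egfC s x =
        CycleEGF.expz (s - 1 / 2) * (PowerSeries.C r * CycleEGF.secz (r / 2)) *
          (PowerSeries.C r - CycleEGF.tanz (r / 2))⁻¹) ∧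
    CycleEGF.egfC s x ^ 2 = CycleEGF.egfM (2 * s) (2 * x) := by
  refine ⟨fun r hr hr0 => CycleEGF.egfC_eq_trigonometric s x r hr hr0, ?_⟩
  obtain ⟨u, hu, hu0, hu1⟩ := CycleEGF.exists_linear_solution x
  rw [CycleEGF.egfC_eq_expz_mul_inv hu hu0 hu1, CycleEGF.egfM_eq_sq hu hu0 hu1]
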